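/- Let $k\ge 1$, $n=4k$, and let $\mathrm{Tr}_n:\mathbb F_{3^n}\to\mathbb F_3$ be the absolute trace. Let $a_1$ be any nonsquare in $\mathbb F_{3^n}$, let $I$ be any primitive $4$th root of unity in $\mathbb F_{3^n}$, and put \[a_2=\pm I^k a_1^{(3^k+1)/2}\left((-1)^k a_1^{(3^k-1)(3^{2k}+1)/4}+a_1^{-(3^k-1)(3^{2k}+1)/4}\right),\] where the sign is arbitrary. Then the function $f:\mathbb F_{3^n}\to\mathbb F_3$, \[f(x)=\mathrm{Tr}_n\left(a_1x^{2(3^k+1)}+a_2x^{(3^k+1)^2}\right),\] is a regular bent function of algebraic degree four belonging to the completed Maiorana–McFarland class. Here, with $\omega=e^{2\pi i/3}$ and $S_f(b)=\sum_{x\in\mathbb F_{3^n}}\omega^{f(x)-\mathrm{Tr}_n(bx)}$, $f$ is bent if $|S_f(b)|^2=3^n$ for all $b\in\mathbb F_{3^n}$, and a bent $f$ is regular if there is a function $f^*:\mathbb F_{3^n}\to\mathbb F_3$ with $3^{-n/2}S_f(b)=\omega^{f^*(b)}$ for all $b$. The algebraic degree of $f$ is the total degree of the polynomial over $\mathbb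 F_3$, of degree at most $2$ in each variable, that represents $f$ in the coordinates of a basis of $\mathbb F_{3^n}$ over $\mathbb F_3$. The Maiorana–McFarland class consists of the functions $h(x,y)=x\cdot\pi(y)+g(y)$ on $\mathbb F_3^m\times\mathbb F_3^m$ with $\pi$ a permutation of $\mathbb F_3^m$ and $g:\mathbb F_3^m\to\mathbb F_3$ arbitrary; $f$ is in the completed class if, for some such $h$, $f=a\,(h\circ L)+l$ with $L$ an affine bijection, $l$ an affine function to $\mathbb F_3$, and $a\in\mathbb F_3^*$. -/

import Mathlib

namespace PAry

/-- The Walsh transform `S_f(b) = ∑ₓ ω ^ (f(x) - Tr(b x))` of `f : F → 𝔽_p`, where `F` is a finite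
field of characteristic `p`, `Tr : F → 𝔽_p` is the absolute trace and `ω = exp(2πi/p)`.
Here `ZMod.stdAddChar j = exp(2πi j/p) = ω ^ j`. -/
noncomputable def walsh (p : ℕ) [NeZero p] {F : Type*} [Field F] [Fintype F] [Algebra (ZMod p) F]
    (f : F → ZMod p) (b : F) : ℂ :=
  ∑ x : F, ZMod.stdAddChar (f x - Algebra.trace (ZMod p) F (b * x))

/-- `f` is bent: `|S_f(b)|² = p ^ n = |F|` for every `b`. -/
def IsBent (p : ℕ) [NeZero p] {F : Type*} [Field F] [Fintype F] [Algebra (ZMod p) F]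
    (f : F → ZMod p) : Prop :=
  ∀ b : F, ‖walsh p f b‖ ^ 2 = (Fintype.card F : ℝ)

/-- `f` is a regular bent function: it is bent and there is a function `g : F → 𝔽_p` (the dual)
with `p ^ (-n/2) * S_f(b) = ω ^ g(b)` for every `b`, where `p ^ n = |F|`. -/
def IsRegularBent (p : ℕ) [NeZero p] {F : Type*} [Field F] [Fintype F] [Algebra (ZMod p) F]
    (f : F → ZMod p) : Prop :=
  IsBent p f ∧ ∃ g : F → ZMod p, ∀ b : F,
    ((√(Fintype.card F : ℝ) : ℝ) : ℂ)⁻¹ * walsh p f b = ZMod.stdAddChar (g b)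

/-- `f : V → 𝔽_p` has algebraic degree `d`: in the coordinates of any basis of `V` over `𝔽_p`, `f` is
given by a reduced polynomial (degree at most `p - 1` in each variable) of total degree `d`.
(The reduced polynomial of a function is unique, and its degree does not depend on the basis.) -/
def HasAlgebraicDegree (p : ℕ) {V : Type*} [AddCommGroup V] [Module (ZMod p) V]
    (f : V → ZMod p) (d : ℕ) : Prop :=
  ∀ e : Module.Basis (Fin (Module.finrank (ZMod p) V)) (ZMod p) V,
    ∃ P ∈ MvPolynomial.restrictDegree (Fin (Module.finrank (ZMod p) V)) (ZMod p) (p - 1),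
      (∀ v : V, f v = MvPolynomial.eval (fun i => e.repr v i) P) ∧ P.totalDegree = d

/-- Extended-affine equivalence: `g = a • (f ∘ L) + l` with `L` an affine bijection, `l` an affine
function and `a ∈ 𝔽_p` nonzero. The domains may be different copies of `𝔽_p ^ n`. -/
def EAEquivalent (p : ℕ) [Fact p.Prime] {V W : Type*} [AddCommGroup V] [Module (ZMod p) V]
    [AddCommGroup W] [Module (ZMod p) W] (f : V → ZMod p) (g : W → ZMod p) : Prop :=
  ∃ (L : W ≃ᵃ[ZMod p] V) (l : W →ᵃ[ZMod p] ZMod p) (a : ZMod p),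
    a ≠ 0 ∧ ∀ x : W, g x = a * f (L x) + l x

/-- The Maiorana–McFarland class: `f(x, y) = x · π(y) + g(y)` on `𝔽_p ^ m × 𝔽_p ^ m`, with `π` a
permutation of `𝔽_p ^ m` and `g` an arbitrary function. -/
def IsMaioranaMcFarland (p m : ℕ) (f : (Fin m → ZMod p) × (Fin m → ZMod p) → ZMod p) : Prop :=
  ∃ (π : Equiv.Perm (Fin m → ZMod p)) (g : (Fin m → ZMod p) → ZMod p),
    ∀ x y, f (x, y) = x ⬝ᵥ π y + g y

/-- The completed Maiorana–McFarland class: the union of the extended-affine equivalence classes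
of the Maiorana–McFarland functions. -/
def InCompletedMaioranaMcFarland (p : ℕ) [Fact p.Prime] {V : Type*} [AddCommGroup V]
    [Module (ZMod p) V] (f : V → ZMod p) : Prop :=
  ∃ (m : ℕ) (h : (Fin m → ZMod p) × (Fin m → ZMod p) → ZMod p),
    IsMaioranaMcFarland p m h ∧ EAEquivalent p h f

end PAry

/-!
Write `q = 3 ^ k`, `σ x = x ^ q`, so that `σ⁴ = 1` on `F` and `f x = Tr(a₁ x² (σx)² + a₂ x (σx)² σ²x)`.
The special shape of `a₂` provides an element `lam` with `lam σ²(lam) = 1` and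
`a₂ = -(lam⁻¹ a₁ + lam σ(a₁))`; since `a₁` is a nonsquare, also `lam² σ(lam)² σ²(a₁) = -a₁`
(`exists_isIsotropicQuartic`). Put `u = σ²x - lam x`. Because `4 = 1` in `𝔽₃`, the value `f x` is also
the trace of the orbit sum of its argument under `σ`, and these relations turn the orbit sum into
`u σ(u)` times a bilinear expression in `(x, u)` and `(σx, σu)`
(`IsIsotropicQuartic.orbitSum_quartic`). Hence, for `w` in the `2k`-dimensional kernel `W` of
`x ↦ σ²x - lam x`, `f (x + w) = f x + Tr(κ u σ(u)² w)` with a constant `κ ≠ 0`.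

The map `u ↦ u σ(u)²` is injective on the range of `x ↦ σ²x - lam x`, so different cosets of `W` carry
different linear functionals on `W`; this puts `f` in the completed Maiorana–McFarland class
(`inCompletedMaioranaMcFarland_of_affine_on_cosets`). Every function of that class is regular bent,
by summing the Walsh transform first along the variable in which the function is affine
(`InCompletedMaioranaMcFarland.isRegularBent`).

The degree is at most four because `f` is the diagonal of a 4-linear form, and exponents can be
reduced modulo `X ^ 3 = X` without raising the degree. If it were at most three, a sum of
Chevalley–Warning type over a three-dimensional subspace (`sum_mul_eq_zero_of_totalDegree_le_three`)
would annihilate the polarisation of `u σ(u)²`. Then `σ(u) / u` would be constant on the nonzero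
elements of a `2k`-dimensional space, whereas `σ(u) = μ u` has at most `3 ^ k` solutions.
-/

namespace PAry

/-! ### Reduced polynomials and algebraic degree -/

section Degree

/-- The exponent of the reduced monomial that defines the same function on `𝔽_p` as `X ^ a`. -/
def reduceExp (p a : ℕ) : ℕ := if a = 0 then 0 else (a - 1) % (p - 1) + 1

lemma reduceExp_zero (p : ℕ) : reduceExp p 0 = 0 := by simp [reduceExp]

lemma reduceExp_le_self (p a : ℕ) : reduceExp p a ≤ a := by
  unfold reduceExp
  split_ifs with h
  · exact Nat.zero_le _
  · have := Nat.mod_le (a - 1) (p - 1)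
    omega

lemma reduceExp_le {p : ℕ} (hp : 2 ≤ p) (a : ℕ) : reduceExp p a ≤ p - 1 := by
  unfold reduceExp
  split_ifs with h
  · exact Nat.zero_le _
  · have := Nat.mod_lt (a - 1) (show 0 < p - 1 by omega)
    omega

variable {p : ℕ} [Fact p.Prime]

lemma pow_reduceExp (x : ZMod p) (a : ℕ) : x ^ reduceExp p a = x ^ a := by
  unfold reduceExp
  split_ifs with h
  · rw [h]
  · rcases eq_or_ne x 0 with rfl | hx
    · rw [zero_pow (by omega), zero_pow h]
    · conv_rhs => rw [show a = (a - 1) + 1 by omega, pow_succ,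
        ← Nat.mod_add_div (a - 1) (p - 1), pow_add, pow_mul, ZMod.pow_card_sub_one_eq_one hx,
        one_pow, mul_one]
      rw [pow_succ]

/-- Reducing exponents modulo `X ^ p = X` does not change the function and does not raise the total
degree. -/
lemma exists_restrictDegree_eval_eq {σ : Type*} [Fintype σ] (Q : MvPolynomial σ (ZMod p)) :
    ∃ P ∈ MvPolynomial.restrictDegree σ (ZMod p) (p - 1),
      (∀ x, MvPolynomial.eval x P = MvPolynomial.eval x Q) ∧ P.totalDegree ≤ Q.totalDegree := by
  classical
  have hp : 2 ≤ p := (Fact.out : p.Prime).two_le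
  refine ⟨∑ s ∈ Q.support, MvPolynomial.monomial
    (s.mapRange (reduceExp p) (reduceExp_zero p)) (Q.coeff s), ?_, ?_, ?_⟩
  · refine Submodule.sum_mem _ fun s _ => ?_
    rw [MvPolynomial.mem_restrictDegree]
    intro t ht i
    have := MvPolynomial.support_monomial_subset ht
    rw [Finset.mem_singleton] at this
    rw [this, Finsupp.mapRange_apply]
    exact reduceExp_le hp _
  · intro x
    rw [map_sum, MvPolynomial.eval_eq']
    refine Finset.sum_congr rfl fun s _ => ?_
    rw [MvPolynomial.eval_monomial, Finsupp.prod_fintype _ _ (fun i => pow_zero _)]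
    simp only [Finsupp.mapRange_apply, pow_reduceExp]
  · refine MvPolynomial.totalDegree_finsetSum_le fun s hs => ?_
    refine (MvPolynomial.totalDegree_monomial_le _ _).trans
      (le_trans ?_ (MvPolynomial.le_totalDegree hs))
    rw [Finsupp.sum_fintype _ _ (fun _ => rfl), Finsupp.sum_fintype _ _ (fun _ => rfl)]
    exact Finset.sum_le_sum fun i _ => reduceExp_le_self p _

/-- The diagonal of an `n`-linear form is a polynomial of total degree at most `n` in the
coordinates of any basis. -/
lemma exists_totalDegree_le_of_multilinear {K V ι : Type*} [Field K] [AddCommGroup V] [Module K V]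
    [Fintype ι] (e : Module.Basis ι K V) {n : ℕ} (M : MultilinearMap K (fun _ : Fin n => V) K) :
    ∃ Q : MvPolynomial ι K,
      (∀ v, M (fun _ => v) = MvPolynomial.eval (fun i => e.repr v i) Q) ∧ Q.totalDegree ≤ n := by
  classical
  refine ⟨∑ r : Fin n → ι, MvPolynomial.C (M fun i => e (r i)) * ∏ i, MvPolynomial.X (r i), ?_, ?_⟩
  · intro v
    conv_lhs => rw [← e.sum_repr v]
    rw [MultilinearMap.map_sum M, map_sum]
    refine Finset.sum_congr rfl fun r _ => ?_
    rw [MultilinearMap.map_smul_univ]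
    simp [mul_comm]
  · refine MvPolynomial.totalDegree_finsetSum_le fun r _ => ?_
    refine (MvPolynomial.totalDegree_mul _ _).trans ?_
    rw [MvPolynomial.totalDegree_C, zero_add]
    refine (MvPolynomial.totalDegree_finsetProd _ _).trans ?_
    simp

lemma totalDegree_bind₁_le {R σ τ : Type*} [CommSemiring R] (g : σ → MvPolynomial τ R)
    (hg : ∀ i, (g i).totalDegree ≤ 1) (P : MvPolynomial σ R) :
    (MvPolynomial.bind₁ g P).totalDegree ≤ P.totalDegree := by
  classical
  rw [MvPolynomial.bind₁, MvPolynomial.aeval_def, MvPolynomial.eval₂_eq]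
  refine MvPolynomial.totalDegree_finsetSum_le fun s hs => ?_
  refine (MvPolynomial.totalDegree_mul _ _).trans ?_
  rw [MvPolynomial.algebraMap_eq, MvPolynomial.totalDegree_C, zero_add]
  refine (MvPolynomial.totalDegree_finsetProd _ _).trans
    (le_trans ?_ (MvPolynomial.le_totalDegree hs))
  refine Finset.sum_le_sum fun i _ => (MvPolynomial.totalDegree_pow _ _).trans ?_
  simpa using Nat.mul_le_mul_left (s i) (hg i)

/-- Restricted to a three-dimensional parametrised subspace and multiplied by the monomial
`s₀ s₁`, a ternary function of degree at most three has degree at most five, less than the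
`(3 - 1) * 3` needed for its values to have a nonzero sum. -/
lemma sum_mul_eq_zero_of_totalDegree_le_three {V ι : Type*} [AddCommGroup V] [Module (ZMod 3) V]
    [Finite ι] (e : Module.Basis ι (ZMod 3) V) (f : V → ZMod 3) (P : MvPolynomial ι (ZMod 3))
    (hP : ∀ v, f v = MvPolynomial.eval (fun i => e.repr v i) P) (hd : P.totalDegree ≤ 3)
    (w y z : V) :
    ∑ a : ZMod 3, ∑ b : ZMod 3, ∑ c : ZMod 3, a * b * f (a • w + b • y + c • z) = 0 := by
  classical
  let g : ι → MvPolynomial (Fin 3) (ZMod 3) := fun i =>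
    ∑ j, MvPolynomial.C (e.repr (![w, y, z] j) i) * MvPolynomial.X j
  have hg : ∀ i, (g i).totalDegree ≤ 1 := fun i => by
    refine MvPolynomial.totalDegree_finsetSum_le fun j _ => ?_
    refine (MvPolynomial.totalDegree_mul _ _).trans ?_
    rw [MvPolynomial.totalDegree_C, MvPolynomial.totalDegree_X]
  have key := MvPolynomial.sum_eval_eq_zero
    (MvPolynomial.X 0 * MvPolynomial.X 1 * MvPolynomial.bind₁ g P) (by
      have h1 := totalDegree_bind₁_le g hg P
      have h2 := MvPolynomial.totalDegree_mul
        (MvPolynomial.X 0 * MvPolynomial.X 1 : MvPolynomial (Fin 3) (ZMod 3))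
        (MvPolynomial.bind₁ g P)
      have h3 := MvPolynomial.totalDegree_mul
        (MvPolynomial.X 0 : MvPolynomial (Fin 3) (ZMod 3)) (MvPolynomial.X 1)
      rw [MvPolynomial.totalDegree_X, MvPolynomial.totalDegree_X] at h3
      rw [ZMod.card, Fintype.card_fin]
      omega)
  rw [← key]
  let E : (Fin 3 → ZMod 3) ≃ ZMod 3 × ZMod 3 × ZMod 3 :=
    { toFun := fun s => (s 0, s 1, s 2)
      invFun := fun t => ![t.1, t.2.1, t.2.2]
      left_inv := fun s => by
        funext i
        fin_cases i <;> rfl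
      right_inv := fun _ => rfl }
  have hE : ∑ a : ZMod 3, ∑ b : ZMod 3, ∑ c : ZMod 3, a * b * f (a • w + b • y + c • z) =
      ∑ s : Fin 3 → ZMod 3, s 0 * s 1 * f (∑ j, s j • ![w, y, z] j) := by
    rw [← E.symm.sum_comp, Fintype.sum_prod_type]
    refine Finset.sum_congr rfl fun a _ => ?_
    rw [Fintype.sum_prod_type]
    refine Finset.sum_congr rfl fun b _ => Finset.sum_congr rfl fun c _ => ?_
    simp [E, Fin.sum_univ_three, Equiv.symm]
  rw [hE]
  refine Finset.sum_congr rfl fun s _ => ?_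
  have hb : MvPolynomial.eval s (MvPolynomial.bind₁ g P) =
      MvPolynomial.eval (fun i => MvPolynomial.eval s (g i)) P :=
    MvPolynomial.eval₂Hom_bind₁ (RingHom.id _) s g P
  have hs : (fun i => e.repr (∑ j, s j • ![w, y, z] j) i) = fun i => MvPolynomial.eval s (g i) := by
    funext i
    simp [g, mul_comm]
  rw [map_mul, map_mul, MvPolynomial.eval_X, MvPolynomial.eval_X, hP, hb, hs]

end Degree

/-! ### The completed Maiorana–McFarland class -/

section MaioranaMcFarland

variable {p : ℕ} [Fact p.Prime]

/-- If `f` is affine along the cosets of a subspace `W` of at most half the dimension, and the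
linear parts on distinct cosets are distinct functionals on `W`, then `f` is in the completed
Maiorana–McFarland class. Counting functionals shows that `W` has exactly half the dimension. -/
lemma inCompletedMaioranaMcFarland_of_affine_on_cosets {V : Type*} [AddCommGroup V]
    [Module (ZMod p) V] [FiniteDimensional (ZMod p) V] (f : V → ZMod p)
    (W : Submodule (ZMod p) V) (hW : 2 * Module.finrank (ZMod p) W ≤ Module.finrank (ZMod p) V)
    (B : V → Module.Dual (ZMod p) V) (hf : ∀ x, ∀ w ∈ W, f (x + w) = f x + B x w)
    (hB : ∀ x y, (∀ w ∈ W, B x w = B y w) → x - y ∈ W) :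
    InCompletedMaioranaMcFarland p f := by
  classical
  obtain ⟨C, hC⟩ := Submodule.exists_isCompl W
  have hfin := Submodule.finrank_add_eq_of_isCompl hC
  set m := Module.finrank (ZMod p) W with hm
  let b : Module.Basis (Fin m) (ZMod p) W := Module.finBasis (ZMod p) W
  let c : Module.Basis (Fin (Module.finrank (ZMod p) C)) (ZMod p) C := Module.finBasis (ZMod p) C
  have hinj : Function.Injective (fun (y : C) (i : Fin m) => B y (b i)) := by
    intro y y' h
    have h1 : ∀ w ∈ W, B y w = B y' w := by
      have : (B y).comp W.subtype = (B y').comp W.subtype :=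
        b.ext fun i => congrFun h i
      intro w hw
      exact LinearMap.congr_fun this ⟨w, hw⟩
    have h2 := hB _ _ h1
    have h3 : (y : V) - y' ∈ C := C.sub_mem y.2 y'.2
    have := Submodule.disjoint_def.1 hC.disjoint _ h2 h3
    exact Subtype.ext (sub_eq_zero.1 this)
  have hCm : Module.finrank (ZMod p) C = m := by
    have h1 : Fintype.card (Fin (Module.finrank (ZMod p) C) → ZMod p) ≤
        Fintype.card (Fin m → ZMod p) :=
      Fintype.card_le_of_injective _ (hinj.comp c.equivFun.symm.injective)
    rw [Fintype.card_fun, Fintype.card_fun, Fintype.card_fin, Fintype.card_fin, ZMod.card] at h1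
    have h2 := (Nat.pow_le_pow_iff_right (Fact.out : p.Prime).one_lt).1 h1
    omega
  let c' : C ≃ₗ[ZMod p] (Fin m → ZMod p) := (c.reindex (finCongr hCm)).equivFun
  let E : ((Fin m → ZMod p) × (Fin m → ZMod p)) ≃ₗ[ZMod p] V :=
    (LinearEquiv.prodCongr b.equivFun.symm c'.symm).trans (Submodule.prodEquivOfIsCompl W C hC)
  let π₀ : (Fin m → ZMod p) → (Fin m → ZMod p) := fun y i => B (c'.symm y) (b i)
  have hπ : Function.Bijective π₀ :=
    Finite.injective_iff_bijective.1 (hinj.comp c'.symm.injective)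
  refine ⟨m, fun z => f (E z), ⟨Equiv.ofBijective π₀ hπ, fun y => f (c'.symm y), ?_⟩,
    E.symm.toAffineEquiv, 0, 1, one_ne_zero, ?_⟩
  · intro x y
    have hE : E (x, y) = (c'.symm y : V) + (b.equivFun.symm x : V) := by
      simp only [E, LinearEquiv.trans_apply, LinearEquiv.prodCongr_apply,
        Submodule.coe_prodEquivOfIsCompl']
      exact add_comm _ _
    change f (E (x, y)) = _
    rw [hE, hf _ _ (b.equivFun.symm x).2, add_comm]
    congr 1
    rw [b.equivFun_symm_apply]
    simp [π₀, dotProduct]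
  · intro x
    simp

/-- Orthogonality of the characters `x ↦ ω ^ (x · c)` of `𝔽_p ^ m`. -/
lemma sum_stdAddChar_dotProduct {m : ℕ} (c : Fin m → ZMod p) :
    ∑ x : Fin m → ZMod p, (ZMod.stdAddChar (x ⬝ᵥ c) : ℂ) = if c = 0 then (p : ℂ) ^ m else 0 := by
  split_ifs with h
  · simp [h]
  · let φ : (Fin m → ZMod p) →+ ZMod p :=
      { toFun := fun x => x ⬝ᵥ c
        map_zero' := zero_dotProduct c
        map_add' := fun x y => add_dotProduct x y c }
    refine AddChar.sum_eq_zero_of_ne_one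
      (ψ := (ZMod.stdAddChar (N := p)).compAddMonoidHom φ) ?_
    intro h1
    apply h
    funext i
    have h2 := DFunLike.congr_fun h1 (Pi.single i 1)
    rw [AddChar.compAddMonoidHom_apply, AddChar.one_apply,
      ← AddChar.map_zero_eq_one (ZMod.stdAddChar (N := p))] at h2
    simpa [φ] using ZMod.injective_stdAddChar h2

/-- Every function in the completed Maiorana–McFarland class is regular bent: summing first over
the variable in which it is affine, the Walsh transform collapses to a single term. -/
lemma InCompletedMaioranaMcFarland.isRegularBent {F : Type*} [Field F] [Fintype F]
    [Algebra (ZMod p) F] {f : F → ZMod p} (hf : InCompletedMaioranaMcFarland p f) :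
    IsRegularBent p f := by
  classical
  obtain ⟨m, h, ⟨π, g, hh⟩, L, l, a, ha, hL⟩ := hf
  have hcard : Fintype.card F = p ^ m * p ^ m := by
    rw [Fintype.card_congr L.toEquiv, Fintype.card_prod, Fintype.card_fun, Fintype.card_fin,
      ZMod.card]
  have hpm : (0 : ℝ) ≤ (p : ℝ) ^ m := by positivity
  have hsqrt : √(Fintype.card F : ℝ) = (p : ℝ) ^ m := by
    rw [hcard]
    push_cast
    exact Real.sqrt_mul_self hpm
  have key : ∀ b : F, ∃ j : ZMod p, walsh p f b = (p : ℂ) ^ m * ZMod.stdAddChar j := by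
    intro b
    let T : F →ₗ[ZMod p] ZMod p := (Algebra.trace (ZMod p) F).comp (LinearMap.mulLeft (ZMod p) b)
    let A : (Fin m → ZMod p) × (Fin m → ZMod p) →ᵃ[ZMod p] ZMod p :=
      (l - T.toAffineMap).comp L.symm.toAffineMap
    let v : Fin m → ZMod p := fun i => A.linear (Pi.single i 1, 0)
    have hA : ∀ x y, A (x, y) = x ⬝ᵥ v + A (0, y) := by
      intro x y
      have h1 : A (x, y) = A.linear (x, 0) + A (0, y) := by
        have := A.map_vadd (0, y) (x, 0)
        simpa using this
      have h2 : A.linear (x, 0) = x ⬝ᵥ v := by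
        have h3 : ((x, 0) : (Fin m → ZMod p) × (Fin m → ZMod p)) =
            ∑ i, x i • ((Pi.single i 1, 0) : (Fin m → ZMod p) × (Fin m → ZMod p)) := by
          refine Prod.ext ?_ ?_
          · rw [Prod.fst_sum]
            exact pi_eq_sum_univ' x
          · simp [Prod.snd_sum]
        rw [h3, map_sum]
        refine Finset.sum_congr rfl fun i _ => ?_
        rw [map_smul, smul_eq_mul]
      rw [h1, h2]
    have hterm : ∀ x y, f (L.symm (x, y)) - Algebra.trace (ZMod p) F (b * L.symm (x, y)) =
        x ⬝ᵥ (a • π y + v) + (a * g y + A (0, y)) := by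
      intro x y
      have h1 : f (L.symm (x, y)) - Algebra.trace (ZMod p) F (b * L.symm (x, y)) =
          a * h (x, y) + A (x, y) := by
        rw [hL, L.apply_symm_apply]
        simp [A, T]
        ring
      rw [h1, hA, hh, dotProduct_add, dotProduct_smul, smul_eq_mul]
      ring
    let y₀ : Fin m → ZMod p := π.symm (-(a⁻¹ • v))
    have hy₀ : ∀ y, a • π y + v = 0 ↔ y = y₀ := by
      intro y
      rw [Equiv.eq_symm_apply, add_eq_zero_iff_eq_neg, ← smul_neg]
      exact (eq_inv_smul_iff₀ ha).symm
    refine ⟨a * g y₀ + A (0, y₀), ?_⟩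
    have hw : walsh p f b = ∑ y, ∑ x, ZMod.stdAddChar
        (f (L.symm (x, y)) - Algebra.trace (ZMod p) F (b * L.symm (x, y))) := by
      unfold walsh
      rw [← Fintype.sum_prod_type_right
        (f := fun z : (Fin m → ZMod p) × (Fin m → ZMod p) => (ZMod.stdAddChar
        (f (L.symm z) - Algebra.trace (ZMod p) F (b * L.symm z)) : ℂ))]
      exact (L.symm.toEquiv.sum_comp (fun x => (ZMod.stdAddChar
        (f x - Algebra.trace (ZMod p) F (b * x)) : ℂ))).symm
    rw [hw]
    simp_rw [hterm, AddChar.map_add_eq_mul, ← Finset.sum_mul, sum_stdAddChar_dotProduct, hy₀]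
    simp
  refine ⟨fun b => ?_, ?_⟩
  · obtain ⟨j, hj⟩ := key b
    rw [hj, norm_mul, AddChar.norm_apply, mul_one, norm_pow, Complex.norm_natCast, hcard]
    push_cast
    ring
  · choose j hj using key
    refine ⟨j, fun b => ?_⟩
    have hp0 : (p : ℂ) ^ m ≠ 0 := pow_ne_zero _ (Nat.cast_ne_zero.2 (Fact.out : p.Prime).ne_zero)
    rw [hsqrt, hj]
    push_cast
    rw [inv_mul_cancel_left₀ hp0]

end MaioranaMcFarland

/-! ### A quartic trace form attached to an automorphism of order four -/

section QuarticForm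

variable {F : Type*} [Field F] [Algebra (ZMod 3) F]

/-- The relations between the coefficients of `x ↦ Tr(a₁ x² (σx)² + a₂ x (σx)² σ²x)` that make this
form vanish on the half-dimensional subspace `σ²x = lam x` and be affine on its cosets. Here
`σ⁴ = 1`, `α = σ²a₁` and `β = lam⁻² σ³a₁`. -/
structure IsIsotropicQuartic (σ : F ≃ₐ[ZMod 3] F) (a₁ a₂ lam α β : F) : Prop where
  pow_four : ∀ x, σ (σ (σ (σ x))) = x
  norm_eq_one : lam * σ (σ lam) = 1
  map_α : σ α = lam ^ 2 * β
  map_β : σ β = -(lam ^ 2 * α)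
  a₁_eq : a₁ = -(lam ^ 2 * σ lam ^ 2 * α)
  a₂_eq : a₂ = lam * σ lam ^ 2 * (α + β)
  α_ne_zero : α ≠ 0

lemma three_eq_zero (F : Type*) [Field F] [Algebra (ZMod 3) F] : (3 : F) = 0 := by
  have h : algebraMap (ZMod 3) F 3 = 0 := by
    rw [show (3 : ZMod 3) = 0 from rfl, map_zero]
  rwa [map_ofNat] at h

/-- The sum `z + σz + σ²z + σ³z`, the relative trace to the fixed field when `σ` has order four. -/
def orbitSum (σ : F ≃ₐ[ZMod 3] F) (z : F) : F := z + σ z + σ (σ z) + σ (σ (σ z))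

/-- The trace is invariant under `σ` and `4 = 1` in `𝔽₃`. -/
lemma trace_orbitSum (σ : F ≃ₐ[ZMod 3] F) (z : F) :
    Algebra.trace (ZMod 3) F (orbitSum σ z) = Algebra.trace (ZMod 3) F z := by
  simp only [orbitSum, map_add, Algebra.trace_eq_of_algEquiv]
  generalize Algebra.trace (ZMod 3) F z = t
  revert t
  decide

/-- The linear map `x ↦ σ²x - lam x`. -/
noncomputable def twist (σ : F ≃ₐ[ZMod 3] F) (lam : F) : F →ₗ[ZMod 3] F :=
  σ.toLinearMap.comp σ.toLinearMap - LinearMap.mulLeft (ZMod 3) lam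

lemma twist_apply (σ : F ≃ₐ[ZMod 3] F) (lam x : F) : twist σ lam x = σ (σ x) - lam * x := rfl

lemma mem_ker_twist {σ : F ≃ₐ[ZMod 3] F} {lam x : F} :
    x ∈ LinearMap.ker (twist σ lam) ↔ σ (σ x) = lam * x := by
  rw [LinearMap.mem_ker, twist_apply, sub_eq_zero]

/-- The quartic trace form `Tr(a₁ x² (σx)² + a₂ x (σx)² σ²x)`. -/
noncomputable def quartic (σ : F ≃ₐ[ZMod 3] F) (a₁ a₂ x : F) : ZMod 3 :=
  Algebra.trace (ZMod 3) F (a₁ * x ^ 2 * σ x ^ 2 + a₂ * x * σ x ^ 2 * σ (σ x))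

namespace IsIsotropicQuartic

variable {σ : F ≃ₐ[ZMod 3] F} {a₁ a₂ lam α β : F} (h : IsIsotropicQuartic σ a₁ a₂ lam α β)
include h

lemma lam_ne_zero : lam ≠ 0 := left_ne_zero_of_mul_eq_one h.norm_eq_one

lemma map_map_lam : σ (σ lam) = lam⁻¹ := eq_inv_of_mul_eq_one_right h.norm_eq_one

lemma map_lam_ne_zero : σ lam ≠ 0 := (map_ne_zero σ).2 h.lam_ne_zero

lemma map_map_twist (x : F) : σ (σ (twist σ lam x)) = -(lam⁻¹ * twist σ lam x) := by
  have := h.lam_ne_zero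
  simp only [twist_apply, map_sub, map_mul, h.map_map_lam, h.pow_four]
  field_simp
  ring

/-- The orbit sum of the quartic form is divisible by `u σ(u)`, where `u = σ²x - lam x`. -/
lemma orbitSum_quartic (x : F) :
    orbitSum σ (a₁ * x ^ 2 * σ x ^ 2 + a₂ * x * σ x ^ 2 * σ (σ x)) =
      lam * (α - β) * twist σ lam x * σ (twist σ lam x) ^ 2 * x +
      σ lam * (α + β) * twist σ lam x ^ 2 * σ (twist σ lam x) * σ x +
      α * twist σ lam x ^ 2 * σ (twist σ lam x) ^ 2 := by
  have h0 := h.lam_ne_zero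
  have h1 := h.map_lam_ne_zero
  simp only [orbitSum, twist_apply, map_sub, map_mul, map_add, map_pow, map_neg, h.a₁_eq, h.a₂_eq, h.map_α,
    h.map_β, h.map_map_lam, h.pow_four, map_inv₀]
  field_simp
  ring

lemma orbitSum_linear_part (x w : F) (hw : σ (σ w) = lam * w) :
    orbitSum σ (lam * (β - α) * twist σ lam x * σ (twist σ lam x) ^ 2 * w) =
      2 * (lam * (β - α)) * twist σ lam x * σ (twist σ lam x) ^ 2 * w -
      2 * (σ lam * (α + β)) * twist σ lam x ^ 2 * σ (twist σ lam x) * σ w := by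
  have h0 := h.lam_ne_zero
  have h1 := h.map_lam_ne_zero
  have hu := h.map_map_twist x
  generalize twist σ lam x = u at *
  simp only [orbitSum, map_sub, map_mul, map_pow, map_neg, h.map_α,
    h.map_β, h.map_map_lam, hw, hu, map_inv₀]
  field_simp
  ring

/-- The quartic form is affine on the cosets of the kernel of `twist σ lam`. -/
lemma quartic_add (x w : F) (hw : w ∈ LinearMap.ker (twist σ lam)) :
    quartic σ a₁ a₂ (x + w) = quartic σ a₁ a₂ x + Algebra.trace (ZMod 3) F
      (lam * (β - α) * twist σ lam x * σ (twist σ lam x) ^ 2 * w) := by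
  have hu : twist σ lam (x + w) = twist σ lam x := by
    rw [map_add, LinearMap.mem_ker.1 hw, add_zero]
  have e1 := h.orbitSum_quartic (x + w)
  have e2 := h.orbitSum_quartic x
  have e3 := h.orbitSum_linear_part x w (mem_ker_twist.1 hw)
  rw [hu] at e1
  rw [quartic, quartic, ← trace_orbitSum σ, e1]
  conv_rhs => rw [← trace_orbitSum σ, e2, ← trace_orbitSum σ (_ * w), e3, ← map_add]
  congr 1
  rw [map_add]
  linear_combination
    (-(lam * (β - α)) * twist σ lam x * σ (twist σ lam x) ^ 2 * w +
      (σ lam * (α + β)) * twist σ lam x ^ 2 * σ (twist σ lam x) * σ w) * three_eq_zero F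

lemma coeff_ne_zero : lam * (β - α) ≠ 0 := by
  refine mul_ne_zero h.lam_ne_zero fun hβ => h.α_ne_zero ?_
  rw [sub_eq_zero] at hβ
  have h1 := h.map_α
  have h2 := h.map_β
  rw [hβ] at h1 h2
  have h3 : lam ^ 2 * α = 0 := by
    linear_combination h1 - h2 + lam ^ 2 * α * three_eq_zero F
  exact (mul_eq_zero.1 h3).resolve_left (pow_ne_zero 2 h.lam_ne_zero)

/-- An element of the `σ²`-eigenline with eigenvalue `lam⁻¹` is determined by the functional
`w ↦ Tr(θ w)` on the eigenline with eigenvalue `lam`. -/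
lemma eq_zero_of_trace_mul_eq_zero [Finite F] {θ : F} (hθ : lam * σ (σ θ) = θ)
    (ht : ∀ w ∈ LinearMap.ker (twist σ lam), Algebra.trace (ZMod 3) F (θ * w) = 0) : θ = 0 := by
  have h0 := h.lam_ne_zero
  refine (traceForm_nondegenerate (ZMod 3) F).1 θ fun x => ?_
  rw [Algebra.traceForm_apply]
  -- the projection of `x` onto the eigenline, up to a scalar
  have h1 := ht (x + lam⁻¹ * σ (σ x)) (by
    rw [mem_ker_twist]
    simp only [map_add, map_mul, map_inv₀, h.map_map_lam, h.pow_four, inv_inv]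
    field_simp
    ring)
  have h2 : Algebra.trace (ZMod 3) F (θ * (lam⁻¹ * σ (σ x))) =
      Algebra.trace (ZMod 3) F (θ * x) := by
    rw [← Algebra.trace_eq_of_algEquiv σ, ← Algebra.trace_eq_of_algEquiv σ]
    congr 1
    simp only [map_mul, map_inv₀, h.map_map_lam, h.pow_four, inv_inv]
    linear_combination x * hθ
  rw [mul_add, map_add, h2] at h1
  generalize Algebra.trace (ZMod 3) F (θ * x) = t at h1
  revert t
  decide

/-- `u ↦ u σ(u)²` is injective on the range of `twist σ lam`: the quotient `r` of two nonzero
elements with the same image satisfies `r σ(r)² = 1` and `σ²r = r`, so `r σ(r) ^ 2 = σ(r) r ^ 2`,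
whence `σ r = r`, `r ^ 3 = 1` and `r = 1`. -/
lemma cubic_injOn {x y : F}
    (hxy : twist σ lam x * σ (twist σ lam x) ^ 2 = twist σ lam y * σ (twist σ lam y) ^ 2) :
    twist σ lam x = twist σ lam y := by
  have hx := h.map_map_twist x
  have hy := h.map_map_twist y
  generalize twist σ lam x = u at *
  generalize twist σ lam y = v at *
  have h0 := h.lam_ne_zero
  by_cases hv : v = 0
  · rw [hv, zero_mul] at hxy
    rw [hv]
    rcases mul_eq_zero.1 hxy with h1 | h1
    · exact h1
    · exact (map_eq_zero σ).1 (pow_eq_zero_iff two_ne_zero |>.1 h1)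
  have hv' : σ v ≠ 0 := (map_ne_zero σ).2 hv
  have hr2 : σ (σ (u / v)) = u / v := by
    rw [map_div₀, map_div₀, hx, hy]
    field_simp
  have hr : u / v * σ (u / v) ^ 2 = 1 := by
    rw [map_div₀]
    field_simp
    exact hxy
  rw [← div_eq_one_iff_eq hv]
  generalize u / v = r at *
  have hr' : σ r * r ^ 2 = 1 := by
    have := congrArg σ hr
    rwa [map_mul, map_pow, hr2, map_one] at this
  have hr0 : r ≠ 0 := left_ne_zero_of_mul_eq_one hr
  have hsr0 : σ r ≠ 0 := left_ne_zero_of_mul_eq_one hr'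
  have hfix : σ r = r := by
    have : r * σ r * (σ r - r) = 0 := by linear_combination hr - hr'
    exact sub_eq_zero.1 ((mul_eq_zero.1 this).resolve_left (mul_ne_zero hr0 hsr0))
  rw [hfix] at hr'
  -- in characteristic three, `r ^ 3 - 1 = (r - 1) ^ 3`
  have hcube : (r - 1) ^ 3 = 0 := by
    linear_combination hr' - (r ^ 2 - r) * three_eq_zero F
  exact sub_eq_zero.1 (pow_eq_zero_iff three_ne_zero |>.1 hcube)

lemma inCompletedMaioranaMcFarland [Finite F]
    (hW : 2 * Module.finrank (ZMod 3) (LinearMap.ker (twist σ lam)) ≤ Module.finrank (ZMod 3) F) :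
    InCompletedMaioranaMcFarland 3 (quartic σ a₁ a₂) := by
  refine inCompletedMaioranaMcFarland_of_affine_on_cosets _ (LinearMap.ker (twist σ lam)) hW
    (fun x => (Algebra.trace (ZMod 3) F).comp (LinearMap.mulLeft (ZMod 3)
      (lam * (β - α) * twist σ lam x * σ (twist σ lam x) ^ 2)))
    (fun x w hw => h.quartic_add x w hw) fun x y hxy => ?_
  rw [LinearMap.mem_ker, map_sub, sub_eq_zero]
  refine h.cubic_injOn (sub_eq_zero.1 ((mul_eq_zero.1 ?_).resolve_left h.coeff_ne_zero))
  refine h.eq_zero_of_trace_mul_eq_zero ?_ fun w hw => ?_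
  · have h0 := h.lam_ne_zero
    have h1 := h.map_lam_ne_zero
    have hx := h.map_map_twist x
    have hy := h.map_map_twist y
    simp only [map_sub, map_mul, map_pow, h.map_map_lam, hx, hy, map_neg, h.map_α, h.map_β,
      map_inv₀]
    field_simp
    ring
  · have := hxy w hw
    simp only [LinearMap.comp_apply, LinearMap.mulLeft_apply] at this
    rw [mul_sub, sub_mul, map_sub, sub_eq_zero, ← mul_assoc, ← mul_assoc]
    exact this

/-- The coefficient of `t₀ t₁ t₂²` in the restriction of the quartic form to the span of `w`, `y`
and `z`, for `w` in the kernel of `twist σ lam`, vanishes if the degree is at most three. -/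
lemma trace_polar_eq_zero {ι : Type*} [Finite ι] (e : Module.Basis ι (ZMod 3) F)
    (P : MvPolynomial ι (ZMod 3))
    (hP : ∀ v, quartic σ a₁ a₂ v = MvPolynomial.eval (fun i => e.repr v i) P)
    (hd : P.totalDegree ≤ 3) {w : F} (hw : w ∈ LinearMap.ker (twist σ lam)) (y z : F) :
    Algebra.trace (ZMod 3) F (lam * (β - α) * (twist σ lam y * σ (twist σ lam z) ^ 2 +
      2 * twist σ lam z * σ (twist σ lam y) * σ (twist σ lam z)) * w) = 0 := by
  have key := sum_mul_eq_zero_of_totalDegree_le_three e _ P hP hd w y z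
  set κ := lam * (β - α)
  set Y := twist σ lam y 
  set Z := twist σ lam z 
  set T := Algebra.trace (ZMod 3) F
  have hval : ∀ a b c : ZMod 3, quartic σ a₁ a₂ (a • w + b • y + c • z) =
      quartic σ a₁ a₂ (b • y + c • z) + a * (b ^ 3 * T (κ * (Y * σ Y ^ 2) * w) +
        b ^ 2 * c * T (κ * (Z * σ Y ^ 2 + 2 * Y * σ Y * σ Z) * w) +
        b * c ^ 2 * T (κ * (Y * σ Z ^ 2 + 2 * Z * σ Y * σ Z) * w) +
        c ^ 3 * T (κ * (Z * σ Z ^ 2) * w)) := by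
    intro a b c
    rw [show a • w + b • y + c • z = b • y + c • z + a • w by abel,
      h.quartic_add _ _ (Submodule.smul_mem _ a hw)]
    congr 1
    simp only [← smul_eq_mul (a := (_ : ZMod 3)), ← map_smul, ← map_add]
    congr 1
    have hU : twist σ lam (b • y + c • z) = b • Y + c • Z := by
      rw [map_add, map_smul, map_smul]
    rw [hU, map_add, map_smul, map_smul]
    simp only [Algebra.smul_def, map_mul, map_pow, Algebra.algebraMap_self_apply]
    ring
  simp only [hval] at key
  generalize T (κ * (Y * σ Y ^ 2) * w) = t₁ at key
  generalize T (κ * (Z * σ Y ^ 2 + 2 * Y * σ Y * σ Z) * w) = t₂ at key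
  generalize T (κ * (Y * σ Z ^ 2 + 2 * Z * σ Y * σ Z) * w) = t₃ at key ⊢
  generalize T (κ * (Z * σ Z ^ 2) * w) = t₄ at key
  have ha : ∀ b g t : ZMod 3, ∑ a : ZMod 3, a * b * (g + a * t) = -(b * t) := by decide
  have hsum : ∀ t₁ t₂ t₃ t₄ : ZMod 3, ∑ b : ZMod 3, ∑ c : ZMod 3,
      -(b * (b ^ 3 * t₁ + b ^ 2 * c * t₂ + b * c ^ 2 * t₃ + c ^ 3 * t₄)) = -t₃ := by decide
  rw [Finset.sum_comm] at key
  simp_rw [fun b : ZMod 3 => Finset.sum_comm (s := (Finset.univ : Finset (ZMod 3)))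
    (t := (Finset.univ : Finset (ZMod 3)))
    (f := fun a c => a * b * (quartic σ a₁ a₂ (b • y + c • z) + a *
      (b ^ 3 * t₁ + b ^ 2 * c * t₂ + b * c ^ 2 * t₃ + c ^ 3 * t₄)))] at key
  simp_rw [ha] at key
  rw [hsum] at key
  exact neg_eq_zero.1 key

/-- The quartic form has degree four: otherwise the polarisation of `u σ(u)²` would vanish, and the
range of `twist σ lam` would be too small. -/
lemma hasAlgebraicDegree [Finite F]
    (hW : 2 * Module.finrank (ZMod 3) (LinearMap.ker (twist σ lam)) ≤ Module.finrank (ZMod 3) F)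
    (hσ : ∀ μ : F, 2 * Module.finrank (ZMod 3)
      (LinearMap.ker (σ.toLinearMap - LinearMap.mulLeft (ZMod 3) μ)) < Module.finrank (ZMod 3) F) :
    HasAlgebraicDegree 3 (quartic σ a₁ a₂) 4 := by
  intro e
  let M₁ : MultilinearMap (ZMod 3) (fun _ : Fin 4 => F) F :=
    (MultilinearMap.mkPiAlgebra (ZMod 3) (Fin 4) F).compLinearMap
      ![LinearMap.id, LinearMap.id, σ.toLinearMap, σ.toLinearMap]
  let M₂ : MultilinearMap (ZMod 3) (fun _ : Fin 4 => F) F :=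
    (MultilinearMap.mkPiAlgebra (ZMod 3) (Fin 4) F).compLinearMap
      ![LinearMap.id, σ.toLinearMap, σ.toLinearMap, σ.toLinearMap.comp σ.toLinearMap]
  obtain ⟨Q, hQ, hQd⟩ := exists_totalDegree_le_of_multilinear e
    ((Algebra.trace (ZMod 3) F).compMultilinearMap (a₁ • M₁ + a₂ • M₂))
  obtain ⟨P, hPr, hPQ, hPd⟩ := exists_restrictDegree_eval_eq Q
  have hP : ∀ v, quartic σ a₁ a₂ v = MvPolynomial.eval (fun i => e.repr v i) P := by
    intro v
    rw [hPQ, ← hQ]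
    simp only [quartic, M₁, M₂, LinearMap.compMultilinearMap_apply, _root_.add_apply,
      _root_.smul_apply, MultilinearMap.compLinearMap_apply,
      MultilinearMap.mkPiAlgebra_apply, Fin.prod_univ_four]
    congr 1
    simp
    ring
  refine ⟨P, hPr, hP, le_antisymm (hPd.trans hQd) ?_⟩
  by_contra! hlt
  have hpos : 0 < Module.finrank (ZMod 3) F := (Nat.zero_le _).trans_lt (hσ 0)
  have hrank := LinearMap.finrank_range_add_finrank_ker (twist σ lam)
  obtain ⟨z, hz⟩ : ∃ z, twist σ lam z ≠ 0 := by
    by_contra! hz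
    have : twist σ lam = 0 := LinearMap.ext hz
    rw [this, LinearMap.range_zero, finrank_bot] at hrank
    rw [this] at hW
    omega
  have hZ : σ (twist σ lam z) ≠ 0 := (map_ne_zero σ).2 hz
  have hle : LinearMap.range (twist σ lam) ≤ LinearMap.ker (σ.toLinearMap -
      LinearMap.mulLeft (ZMod 3) (σ (twist σ lam z) / twist σ lam z)) := by
    rintro _ ⟨y, rfl⟩
    have h0 := h.lam_ne_zero
    have h1 := h.map_lam_ne_zero
    have hy' := h.map_map_twist y
    have hz' := h.map_map_twist z
    have hpol := h.eq_zero_of_trace_mul_eq_zero (θ := lam * (β - α) *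
      (twist σ lam y * σ (twist σ lam z) ^ 2 +
        2 * twist σ lam z * σ (twist σ lam y) * σ (twist σ lam z))) (by
      simp only [map_add, map_sub, map_mul, map_pow, h.map_map_lam, hy', hz', map_neg, h.map_α,
        h.map_β, map_inv₀, map_ofNat]
      field_simp
      ring) fun w hw => h.trace_polar_eq_zero e P hP (by omega) hw y z
    have hpol' := (mul_eq_zero.1 hpol).resolve_left h.coeff_ne_zero
    have h2 : σ (twist σ lam z) *
        (twist σ lam z * σ (twist σ lam y) - twist σ lam y * σ (twist σ lam z)) = 0 := by
      linear_combination -hpol' + twist σ lam z * σ (twist σ lam y) * σ (twist σ lam z) *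
        three_eq_zero F
    have h3 := sub_eq_zero.1 ((mul_eq_zero.1 h2).resolve_left hZ)
    rw [LinearMap.mem_ker, LinearMap.sub_apply, LinearMap.mulLeft_apply, sub_eq_zero,
      AlgEquiv.toLinearMap_apply]
    field_simp
    linear_combination h3
  have := Submodule.finrank_mono hle
  have := hσ (σ (twist σ lam z) / twist σ lam z)
  omega

end IsIsotropicQuartic

end QuarticForm

/-! ### The coefficients of the binomial -/

section Binomial

variable {F : Type*} [Field F] [Algebra (ZMod 3) F]

/-- The kernel of the linearised polynomial `X ^ (3 ^ j) - μ X` has at most `3 ^ j` elements. -/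
lemma finrank_ker_pow_sub_mulLeft_le [Finite F] {j : ℕ} (hj : 0 < j) (φ : F →ₗ[ZMod 3] F)
    (hφ : ∀ x, φ x = x ^ 3 ^ j) (μ : F) :
    Module.finrank (ZMod 3) (LinearMap.ker (φ - LinearMap.mulLeft (ZMod 3) μ)) ≤ j := by
  classical
  have := Fintype.ofFinite F
  set K := LinearMap.ker (φ - LinearMap.mulLeft (ZMod 3) μ)
  have hN : 1 < 3 ^ j := Nat.one_lt_pow hj.ne' (by norm_num)
  let Q : Polynomial F := Polynomial.X ^ 3 ^ j - Polynomial.C μ * Polynomial.X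
  have hdeg : (Polynomial.C μ * Polynomial.X : Polynomial F).natDegree < 3 ^ j :=
    by
    have := Polynomial.natDegree_C_mul_X_pow_le μ 1
    rw [pow_one] at this
    exact this.trans_lt hN
  have hQd : Q.natDegree = 3 ^ j := by
    rw [Polynomial.natDegree_sub_eq_left_of_natDegree_lt] <;> rw [Polynomial.natDegree_X_pow]
    exact hdeg
  have hQ0 : Q ≠ 0 := by
    intro h0
    rw [h0, Polynomial.natDegree_zero] at hQd
    omega
  have hsub : (Finset.univ.filter (· ∈ K)) ⊆ Q.roots.toFinset := by
    intro x hx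
    rw [Finset.mem_filter, LinearMap.mem_ker, LinearMap.sub_apply, hφ,
      LinearMap.mulLeft_apply] at hx
    rw [Multiset.mem_toFinset, Polynomial.mem_roots hQ0]
    simpa [Q, Polynomial.IsRoot] using hx.2
  have hcard : Fintype.card K ≤ 3 ^ j := by
    rw [Fintype.card_subtype]
    calc _ ≤ Q.roots.toFinset.card := Finset.card_le_card hsub
      _ ≤ Q.roots.card := Multiset.toFinset_card_le _
      _ ≤ 3 ^ j := hQd ▸ Polynomial.card_roots' Q
  rw [Module.card_eq_pow_finrank (K := ZMod 3), ZMod.card] at hcard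
  exact (Nat.pow_le_pow_iff_right (by norm_num)).1 hcard

/-- The number `r = (3 ^ k - 1) / 2` has the parity of `k`. -/
lemma exists_half (k : ℕ) : ∃ r, 3 ^ k = 2 * r + 1 ∧ Even (k + r) := by
  induction k with
  | zero => exact ⟨0, rfl, Even.zero⟩
  | succ k ih =>
    obtain ⟨r, hr, he⟩ := ih
    refine ⟨3 * r + 1, by rw [pow_succ, hr]; ring, ?_⟩
    rw [Nat.even_iff] at he ⊢
    omega

lemma pow_half_card_eq_neg_one [Finite F] {a : F} (ha : ¬ IsSquare a) :
    a ^ (Nat.card F / 2) = -1 := by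
  have := Fintype.ofFinite F
  have h0 : a ≠ 0 := by
    rintro rfl
    exact ha (IsSquare.zero)
  have hchar : ringChar F ≠ 2 := by
    have : CharP F 3 := charP_of_injective_algebraMap (algebraMap (ZMod 3) F).injective 3
    rw [ringChar.eq F 3]
    norm_num
  rw [Nat.card_eq_fintype_card]
  exact (FiniteField.pow_dichotomy hchar h0).resolve_left
    fun h1 => ha ((FiniteField.isSquare_iff hchar h0).2 h1)

/-- For a nonsquare `a₁` and the given `a₂` the quartic form is isotropic, with
`lam = -ε I ^ (-k) a₁ ^ ((q - 1) (q² - 1) / 4)` and `q = 3 ^ k`. The two summands of `a₂` are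
`-lam σ(a₁)` and `-lam⁻¹ a₁`. -/
lemma exists_isIsotropicQuartic [Finite F] {k : ℕ} (hF : Nat.card F = 3 ^ (4 * k))
    {a₁ a₂ I ε : F} (ha₁ : ¬ IsSquare a₁) (hI : IsPrimitiveRoot I 4) (hε : ε = 1 ∨ ε = -1)
    (ha₂ : a₂ = ε * I ^ k * a₁ ^ ((3 ^ k + 1) / 2) *
      ((-1) ^ k * a₁ ^ ((3 ^ k - 1) * (3 ^ (2 * k) + 1) / 4)
        + (a₁ ^ ((3 ^ k - 1) * (3 ^ (2 * k) + 1) / 4))⁻¹))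
    (σ : F ≃ₐ[ZMod 3] F) (hσ : ∀ x, σ x = x ^ 3 ^ k) :
    ∃ lam α β, IsIsotropicQuartic σ a₁ a₂ lam α β := by
  obtain ⟨r, hr, hkr⟩ := exists_half k
  have h0 : a₁ ≠ 0 := by
    rintro rfl
    exact ha₁ IsSquare.zero
  have hsq : 3 ^ (2 * k) = (2 * r + 1) ^ 2 := by rw [mul_comm, pow_mul, hr]
  have hfour : ∀ x, σ (σ (σ (σ x))) = x := by
    intro x
    have := Fintype.ofFinite F
    simp only [hσ, ← pow_mul, ← pow_add]
    rw [show k + k + k + k = 4 * k by ring, ← hF, Nat.card_eq_fintype_card, FiniteField.pow_card]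
  -- the quadratic character of `a₁`
  have hchar : a₁ ^ (4 * r * (r + 1) * (2 * r ^ 2 + 2 * r + 1)) = -1 := by
    have h1 := pow_half_card_eq_neg_one ha₁
    rwa [hF, mul_comm 4 k, pow_mul, hr, show (2 * r + 1) ^ 4 =
      1 + 2 * (4 * r * (r + 1) * (2 * r ^ 2 + 2 * r + 1)) by ring,
      Nat.add_mul_div_left _ _ two_pos, Nat.div_eq_of_lt one_lt_two, zero_add] at h1
  have hI4 : I ^ 4 = 1 := hI.pow_eq_one
  have hI2 : I ^ 2 = -1 := by
    have h1 : (I ^ 2 - 1) * (I ^ 2 + 1) = 0 := by linear_combination hI4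
    have h2 : I ^ 2 ≠ 1 := hI.pow_ne_one_of_pos_of_lt two_ne_zero (by norm_num)
    exact eq_neg_of_add_eq_zero_left ((mul_eq_zero.1 h1).resolve_left (sub_ne_zero.2 h2))
  have hε2 : ε ^ 2 = 1 := by rcases hε with rfl | rfl <;> ring
  set lam : F := -ε * I ^ (3 * k) * a₁ ^ (2 * r ^ 2 * (r + 1)) with hlam
  have hlamsq : lam ^ 2 = (-1) ^ k * a₁ ^ (4 * r ^ 2 * (r + 1)) := by
    have h1 : (I ^ (3 * k)) ^ 2 = (-1) ^ k := by
      rw [← pow_mul, show 3 * k * 2 = 2 * (3 * k) by ring, pow_mul, hI2, mul_comm, pow_mul,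
        ← pow_mul, mul_comm, pow_mul]
      norm_num
    rw [hlam, mul_pow, mul_pow, h1, neg_sq, hε2, one_mul, ← pow_mul]
    congr 2
    ring
  have hlam0 : lam ≠ 0 := by
    intro h1
    rw [h1, zero_pow two_ne_zero] at hlamsq
    exact mul_ne_zero (pow_ne_zero _ (neg_ne_zero.2 one_ne_zero)) (pow_ne_zero _ h0) hlamsq.symm
  -- `q² + 1` is twice the odd number `2 r² + 2 r + 1`
  have hnorm : lam * σ (σ lam) = 1 := by
    rw [hσ, hσ, hr, ← pow_mul, ← pow_succ', show (2 * r + 1) * (2 * r + 1) + 1 =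
      2 * (2 * r ^ 2 + 2 * r + 1) by ring, pow_mul, hlamsq, mul_pow, ← pow_mul, ← pow_mul,
      show 4 * r ^ 2 * (r + 1) * (2 * r ^ 2 + 2 * r + 1) =
        4 * r * (r + 1) * (2 * r ^ 2 + 2 * r + 1) * r by ring,
      pow_mul a₁ _ r, hchar, ← pow_add]
    refine Even.neg_one_pow ?_
    rw [show k * (2 * r ^ 2 + 2 * r + 1) + r = (k + r) + 2 * (k * (r ^ 2 + r)) by ring]
    exact hkr.add (even_two_mul _)
  have hmaplam : σ (σ lam) = lam⁻¹ := eq_inv_of_mul_eq_one_right hnorm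
  have hA : a₁ = -(lam ^ 2 * σ lam ^ 2 * σ (σ a₁)) := by
    have h1 : lam ^ 2 * σ lam ^ 2 = a₁ ^ (8 * r ^ 2 * (r + 1) ^ 2) := by
      rw [hσ, hr, ← pow_mul, mul_comm (2 * r + 1) 2, pow_mul, ← pow_succ', hlamsq, mul_pow,
        ← pow_mul, ← pow_mul, show k * (2 * r + 1 + 1) = 2 * (k * (r + 1)) by ring, pow_mul]
      rw [neg_one_sq, one_pow, one_mul]
      congr 1
      ring
    have h2 : a₁ ^ (8 * r ^ 2 * (r + 1) ^ 2) * σ (σ a₁) = -a₁ := by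
      rw [hσ, hσ, hr, ← pow_mul, ← pow_add, show 8 * r ^ 2 * (r + 1) ^ 2 +
        (2 * r + 1) * (2 * r + 1) = 4 * r * (r + 1) * (2 * r ^ 2 + 2 * r + 1) + 1 by ring,
        pow_succ, hchar, neg_one_mul]
    rw [h1, h2, neg_neg]
  -- the formula for `a₂` solved for `lam * a₂`
  have hlama₂ : lam * a₂ = -(a₁ + lam ^ 2 * σ a₁) := by
    have e1 : (3 ^ k + 1) / 2 = r + 1 := by omega
    have e2 : (3 ^ k - 1) * (3 ^ (2 * k) + 1) / 4 = r * (2 * r ^ 2 + 2 * r + 1) := by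
      rw [hsq, hr, Nat.add_sub_cancel]
      refine Nat.div_eq_of_eq_mul_left (by norm_num) ?_
      ring
    rw [e1, e2] at ha₂
    set z := a₁ ^ (r * (2 * r ^ 2 + 2 * r + 1)) with hz
    have hz0 : z ≠ 0 := pow_ne_zero _ h0
    have e3 : a₁ ^ (2 * r ^ 2 * (r + 1)) * a₁ ^ (r + 1) = a₁ * z := by
      rw [hz, ← pow_add, ← pow_succ']
      congr 1
      ring
    have e4 : a₁ ^ (4 * r ^ 2 * (r + 1)) * σ a₁ = a₁ * z ^ 2 := by
      rw [hσ, hr, hz, ← pow_add, ← pow_mul, ← pow_succ']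
      congr 1
      ring
    have e5 : I ^ (3 * k) * I ^ k = 1 := by
      rw [← pow_add, show 3 * k + k = 4 * k by ring, pow_mul, hI4, one_pow]
    have e6 : z * z⁻¹ = 1 := mul_inv_cancel₀ hz0
    rw [hlamsq, ha₂, hlam]
    linear_combination
      (-(ε ^ 2) * (I ^ (3 * k) * I ^ k) * ((-1) ^ k * z + z⁻¹)) * e3 -
      (ε ^ 2 * (a₁ * z) * ((-1) ^ k * z + z⁻¹)) * e5 -
      ((a₁ * z) * ((-1) ^ k * z + z⁻¹)) * hε2 - a₁ * e6 + (-1) ^ k * e4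
  have hA1 : σ a₁ = -(σ lam ^ 2 * lam⁻¹ ^ 2 * σ (σ (σ a₁))) := by
    conv_lhs => rw [hA]
    simp only [map_neg, map_mul, map_pow, hmaplam]
  refine ⟨lam, σ (σ a₁), lam⁻¹ ^ 2 * σ (σ (σ a₁)), hfour, hnorm, ?_, ?_, hA, ?_, ?_⟩
  · field_simp
  · have h1 : σ lam ≠ 0 := (map_ne_zero σ).2 hlam0
    simp only [map_mul, map_pow, map_inv₀, hfour]
    conv_lhs => rw [hA]
    field_simp
  · refine mul_left_cancel₀ hlam0 ?_
    linear_combination hlama₂ - hA - lam ^ 2 * hA1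
  · exact (map_ne_zero σ).2 ((map_ne_zero σ).2 h0)

end Binomial

end PAry

theorem mainTheorem3 {F : Type*} [Field F] [Fintype F] [Algebra (ZMod 3) F]
    (k : ℕ) (hk : 0 < k) (hF : Fintype.card F = 3 ^ (4 * k))
    (a₁ a₂ I ε : F) (ha₁ : ¬ IsSquare a₁) (hI : IsPrimitiveRoot I 4) (hε : ε = 1 ∨ ε = -1)
    (ha₂ : a₂ = ε * I ^ k * a₁ ^ ((3 ^ k + 1) / 2) *
      ((-1) ^ k * a₁ ^ ((3 ^ k - 1) * (3 ^ (2 * k) + 1) / 4)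
        + (a₁ ^ ((3 ^ k - 1) * (3 ^ (2 * k) + 1) / 4))⁻¹))
    (f : F → ZMod 3)
    (hf : ∀ x : F, f x = Algebra.trace (ZMod 3) F
      (a₁ * x ^ (2 * (3 ^ k + 1)) + a₂ * x ^ ((3 ^ k + 1) ^ 2))) :
    PAry.IsRegularBent 3 f ∧ PAry.HasAlgebraicDegree 3 f 4 ∧
      PAry.InCompletedMaioranaMcFarland 3 f := by
  let σ : F ≃ₐ[ZMod 3] F := FiniteField.frobeniusAlgEquivOfAlgebraic (ZMod 3) F ^ k
  have hσ : ∀ x, σ x = x ^ 3 ^ k := fun x => by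
    rw [AlgEquiv.coe_pow, FiniteField.coe_frobeniusAlgEquivOfAlgebraic_iterate, ZMod.card]
  obtain ⟨lam, α, β, h⟩ := PAry.exists_isIsotropicQuartic
    (Nat.card_eq_fintype_card.trans hF) ha₁ hI hε ha₂ σ hσ
  have hfq : f = PAry.quartic σ a₁ a₂ := by
    funext x
    rw [hf, PAry.quartic]
    congr 1
    simp only [hσ]
    ring
  have hrank : Module.finrank (ZMod 3) F = 4 * k := by
    rw [Module.card_eq_pow_finrank (K := ZMod 3), ZMod.card] at hF
    exact Nat.pow_right_injective (by norm_num : 2 ≤ 3) hF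
  have hW : 2 * Module.finrank (ZMod 3) (LinearMap.ker (PAry.twist σ lam)) ≤
      Module.finrank (ZMod 3) F := by
    have := PAry.finrank_ker_pow_sub_mulLeft_le (j := 2 * k) (by omega)
      (σ.toLinearMap.comp σ.toLinearMap) (fun x => by
        simp only [LinearMap.comp_apply, AlgEquiv.toLinearMap_apply, hσ, ← pow_mul, ← pow_add]
        rw [two_mul]) lam
    rw [← PAry.twist] at this
    omega
  have hMM := h.inCompletedMaioranaMcFarland hW
  rw [hfq]
  refine ⟨hMM.isRegularBent, h.hasAlgebraicDegree hW fun μ => ?_, hMM⟩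
  have := PAry.finrank_ker_pow_sub_mulLeft_le hk σ.toLinearMap hσ μ
  omega
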